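/- Let $U\subseteq\mathbb R^N$ be open, with coordinates $u=(u^1,\dots,u^N)$, and let $g_1^{ij}(u)$, $g_2^{ij}(u)$ be two smooth contravariant Riemannian or pseudo-Riemannian metrics on $U$ (symmetric, nondegenerate at every point, of arbitrary signature). For a contravariant metric $g^{ij}$ with inverse $g_{ij}$, let $\Gamma^i_{jk}$ be its Levi-Civita coefficients, $R^i_{jkl}=\partial_k\Gamma^i_{jl}-\partial_l\Gamma^i_{jk}+\Gamma^i_{pk}\Gamma^p_{jl}-\Gamma^i_{pl}\Gamma^p_{jk}$ its curvature tensor, and put $\Gamma^{ij}_k=g^{is}\Gamma^j_{sk}$, $R^{ij}_{kl}=g^{is}R^j_{skl}$ (summation over repeated indices). The metrics $g_1,g_2$ are called *almost compatible* if for all real constants $\lambda_1,\lambda_2$ such that $g^{ij}=\lambda_1g_1^{ij}+\lambda_2g_2^{ij}$ satisfies $\det(g^{ij})\not\equiv0$, one has, wherever $\det (g^{ij}(u))\ne0$, $$\Gamma^{ij}_k=\lambda_1\Gamma^{ij}_{1,k}+\lambda_2\Gamma^{ij}_{2,k};$$ they are called *compatible* if, for all such constants and at all such points, in addition $$R^{ij}_{kl}=\lambda_1R^{ij}_{1,kl}+\lambda_2R^{ij}_{2,kl}.$$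 The pair is called *nonsingular* if at every $u\in U$ the equation $\det(g_1^{ij}(u)-\lambda g_2^{ij}(u))=0$ has $N$ distinct (in general complex) roots $\lambda$. The Nijenhuis tensor of the affinor $v^i_j=g_1^{is}g_{2,sj}$ is $$N^k_{ij}=v^s_i\frac{\partial v^k_j}{\partial u^s}-v^s_j\frac{\partial v^k_i}{\partial u^s}+v^k_s\frac{\partial v^s_i}{\partial u^j}-v^k_s\frac{\partial v^s_j}{\partial u^i}.$$ 1) If $g_1$ and $g_2$ are almost compatible, then the Nijenhuis tensor of $v$ vanishes on $U$. Thus it vanishes for any two compatible or almost compatible metrics. 2) If the pair $g_1,g_2$ is nonsingular and the Nijenhuis tensor of $v$ vanishes on $U$, then $g_1$ and $g_2$ are compatible. Thus a nonsingular pair of metrics is compatible if and only if it is almost compatible. -/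

import Mathlib

/-!
Contravariant (pseudo-)Riemannian metrics on an open domain `U` of `ℝ^N` with coordinates
`u = (u^1, …, u^N)`.  A contravariant metric `g^{ij}(u)` is a matrix-valued function `g`, and
the covariant metric `g_{ij}(u)` is the pointwise inverse matrix `(g u)⁻¹`.
-/

namespace MetricPencil

open scoped ContDiff

noncomputable section

/-- A field of `N × N` matrices in the coordinates `u = (u^1, …, u^N)`. -/
abbrev MatrixField (N : ℕ) : Type := (Fin N → ℝ) → Matrix (Fin N) (Fin N) ℝ

/-- The partial derivative `∂f/∂u^k` at `u`. -/
def pd {N : ℕ} (k : Fin N) (f : (Fin N → ℝ) → ℝ) (u : Fin N → ℝ) : ℝ :=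
  fderiv ℝ f u (Pi.single k 1)

/-- `g` is a smooth contravariant Riemannian or pseudo-Riemannian metric on `U`: symmetric and
nondegenerate, of arbitrary signature. -/
structure IsMetricOn {N : ℕ} (U : Set (Fin N → ℝ)) (g : MatrixField N) : Prop where
  smooth : ∀ i j, ContDiffOn ℝ ∞ (fun u => g u i j) U
  symm : ∀ u ∈ U, (g u).IsSymm
  nondegenerate : ∀ u ∈ U, (g u).det ≠ 0

/-- The Levi-Civita coefficients
`Γ^i_{jk} = (1/2) g^{is} (∂g_{sk}/∂u^j + ∂g_{js}/∂u^k - ∂g_{jk}/∂u^s)`. -/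
def christoffel {N : ℕ} (g : MatrixField N) (i j k : Fin N) (u : Fin N → ℝ) : ℝ :=
  (1 / 2) * ∑ s, g u i s *
    (pd j (fun w => (g w)⁻¹ s k) u + pd k (fun w => (g w)⁻¹ j s) u
      - pd s (fun w => (g w)⁻¹ j k) u)

/-- The coefficients with a raised index, `Γ^{ij}_k = g^{is} Γ^j_{sk}`. -/
def christoffelUp {N : ℕ} (g : MatrixField N) (i j k : Fin N) (u : Fin N → ℝ) : ℝ :=
  ∑ s, g u i s * christoffel g j s k u

/-- The Riemannian curvature tensor
`R^i_{jkl} = ∂Γ^i_{jl}/∂u^k - ∂Γ^i_{jk}/∂u^l + Γ^i_{pk} Γ^p_{jl} - Γ^i_{pl} Γ^p_{jk}`. -/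
def riemann {N : ℕ} (g : MatrixField N) (i j k l : Fin N) (u : Fin N → ℝ) : ℝ :=
  pd k (christoffel g i j l) u - pd l (christoffel g i j k) u
    + ∑ p, christoffel g i p k u * christoffel g p j l u
    - ∑ p, christoffel g i p l u * christoffel g p j k u

/-- The curvature tensor with a raised index, `R^{ij}_{kl} = g^{is} R^j_{skl}`. -/
def riemannUp {N : ℕ} (g : MatrixField N) (i j k l : Fin N) (u : Fin N → ℝ) : ℝ :=
  ∑ s, g u i s * riemann g j s k l u

/-- The linear combination `λ₁ g₁^{ij} + λ₂ g₂^{ij}` with constant coefficients. -/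
def combination {N : ℕ} (c₁ c₂ : ℝ) (g₁ g₂ : MatrixField N) : MatrixField N :=
  fun u => c₁ • g₁ u + c₂ • g₂ u

/-- `Γ^{ij}_k = λ₁ Γ^{ij}_{1,k} + λ₂ Γ^{ij}_{2,k}` at the point `u`. -/
def ConnectionLinearAt {N : ℕ} (c₁ c₂ : ℝ) (g₁ g₂ : MatrixField N) (u : Fin N → ℝ) : Prop :=
  ∀ i j k, christoffelUp (combination c₁ c₂ g₁ g₂) i j k u =
    c₁ * christoffelUp g₁ i j k u + c₂ * christoffelUp g₂ i j k u

/-- `R^{ij}_{kl} = λ₁ R^{ij}_{1,kl} + λ₂ R^{ij}_{2,kl}` at the point `u`. -/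
def CurvatureLinearAt {N : ℕ} (c₁ c₂ : ℝ) (g₁ g₂ : MatrixField N) (u : Fin N → ℝ) : Prop :=
  ∀ i j k l, riemannUp (combination c₁ c₂ g₁ g₂) i j k l u =
    c₁ * riemannUp g₁ i j k l u + c₂ * riemannUp g₂ i j k l u

/-- Almost compatibility: for all constants `λ₁, λ₂` whose combination is not identically
degenerate, the connection relation holds wherever the combination is a metric, i.e. at all
points where its determinant is nonzero (there are none if it is identically degenerate). -/
def AlmostCompatible {N : ℕ} (U : Set (Fin N → ℝ)) (g₁ g₂ : MatrixField N) : Prop :=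
  ∀ c₁ c₂ : ℝ, ∀ u ∈ U, (combination c₁ c₂ g₁ g₂ u).det ≠ 0 →
    ConnectionLinearAt c₁ c₂ g₁ g₂ u

/-- Compatibility: the connection relation and the curvature relation both hold, for all
constants and wherever the combination is nondegenerate. -/
def Compatible {N : ℕ} (U : Set (Fin N → ℝ)) (g₁ g₂ : MatrixField N) : Prop :=
  ∀ c₁ c₂ : ℝ, ∀ u ∈ U, (combination c₁ c₂ g₁ g₂ u).det ≠ 0 →
    ConnectionLinearAt c₁ c₂ g₁ g₂ u ∧ CurvatureLinearAt c₁ c₂ g₁ g₂ u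

/-- At every point of `U` the equation `det (g₁^{ij} - λ g₂^{ij}) = 0`, of degree `N` in `λ`,
has `N` distinct (in general complex) roots. -/
def NonsingularPair {N : ℕ} (U : Set (Fin N → ℝ)) (g₁ g₂ : MatrixField N) : Prop :=
  ∀ u ∈ U,
    {z : ℂ | ((g₁ u).map Complex.ofReal - z • (g₂ u).map Complex.ofReal).det = 0}.ncard = N

/-- The affinor `v^i_j = g₁^{is} g_{2,sj}`. -/
def affinor {N : ℕ} (g₁ g₂ : MatrixField N) : MatrixField N :=
  fun u => g₁ u * (g₂ u)⁻¹

/-- The Nijenhuis tensor of an affinor `v^i_j` (entry `v u i j`),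
`N^k_{ij} = v^s_i ∂v^k_j/∂u^s - v^s_j ∂v^k_i/∂u^s + v^k_s ∂v^s_i/∂u^j - v^k_s ∂v^s_j/∂u^i`. -/
def nijenhuis {N : ℕ} (v : MatrixField N) (k i j : Fin N) (u : Fin N → ℝ) : ℝ :=
  ∑ s, (v u s i * pd s (fun w => v w k j) u - v u s j * pd s (fun w => v w k i) u
    + v u k s * pd j (fun w => v w s i) u - v u k s * pd i (fun w => v w s j) u)

/-- The Nijenhuis tensor of `v` vanishes on `U`. -/
def NijenhuisVanishes {N : ℕ} (U : Set (Fin N → ℝ)) (v : MatrixField N) : Prop :=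
  ∀ u ∈ U, ∀ k i j, nijenhuis v k i j u = 0

end

end MetricPencil

/-!
Write `S = Γ₂ - Γ₁` for the difference of the Levi-Civita connections and `S^j` for its component
with upper index `j`, a symmetric matrix. The contravariant coefficients `Γ^{ij}_k` of a metric `g`
are determined by `∂g^{ij}/∂u^k = -Γ^{ij}_k - Γ^{ji}_k` and by the symmetry of `g^{ks} Γ^{ij}_s` in
`i` and `k`. The first condition is linear in `g`, so the connection of `λ₁ g₁ + λ₂ g₂` is
`λ₁ Γ₁ + λ₂ Γ₂` exactly when the latter satisfies the second one, whose failure is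
`λ₁ λ₂ Q^j` with `Q^j = g₁ S^j g₂ - g₂ S^j g₁`. Computing the Nijenhuis tensor of `v = g₁ g₂⁻¹` with
covariant derivatives of `Γ₂` turns it into `v^k_q (Q^b_{aq} - Q^a_{bq} + Q^q_{ab})`, and the
skewness of each `Q^j` makes the vanishing of this expression equivalent to `Q = 0`.

If `Q = 0`, the curvature of `g = λ₁ g₁ + λ₂ g₂` differs from the linear one by `λ₁ λ₂` times the
skew part of `S^i g₂ g⁻¹ g₁ S^j`. Now `Q^j = 0` says that `g₂ S^j` commutes with `v`; when `v` has
distinct eigenvalues its centralizer is commutative, and then that matrix is symmetric.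
-/

namespace MetricPencil

open Matrix
open scoped ContDiff Topology

section CommCentralizer

/-- The elements commuting with `a` commute with one another. A matrix over a field has this
property if and only if its minimal and characteristic polynomials coincide. -/
def HasCommCentralizer {M : Type*} [Mul M] (a : M) : Prop :=
  ∀ ⦃x y : M⦄, Commute a x → Commute a y → Commute x y

theorem HasCommCentralizer.of_map {M M' F : Type*} [Mul M] [Mul M'] [FunLike F M M']
    [MulHomClass F M M'] {f : F} (hf : Function.Injective f) {a : M}
    (h : HasCommCentralizer (f a)) : HasCommCentralizer a := fun x y hx hy =>
  hf (by simpa only [map_mul] using (h (hx.map f) (hy.map f)).eq)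

theorem hasCommCentralizer_diagonal {K n : Type*} [Field K] [Fintype n] [DecidableEq n]
    {d : n → K} (hd : Function.Injective d) : HasCommCentralizer (diagonal d) := by
  have isDiag {X : Matrix n n K} (hX : Commute (diagonal d) X) : X.IsDiag := fun i j hij => by
    have hentry : d i * X i j = X i j * d j := by
      simpa only [diagonal_mul, mul_diagonal] using congrFun₂ hX.eq i j
    have hprod : (d i - d j) * X i j = 0 := by linear_combination hentry
    exact (mul_eq_zero.1 hprod).resolve_left (sub_ne_zero.2 (hd.ne hij))
  intro X Y hX hY
  rw [← (isDiag hX).diagonal_diag, ← (isDiag hY).diagonal_diag]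
  exact commute_diagonal _ _

theorem hasCommCentralizer_of_ncard_spectrum {K n : Type*} [Field K] [Fintype n] [DecidableEq n]
    {A : Matrix n n K} (hA : (spectrum K A).ncard = Fintype.card n) : HasCommCentralizer A := by
  classical
  have hfin : Fintype (spectrum K A) := A.finite_spectrum.fintype
  have hev (z : spectrum K A) : Module.End.HasEigenvalue (toLin' A) z :=
    Module.End.hasEigenvalue_iff_mem_spectrum.2 (by rw [spectrum_toLin']; exact z.2)
  choose e he using fun z => (hev z).exists_hasEigenvector
  have hcard : Fintype.card (spectrum K A) = Module.finrank K (n → K) := by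
    rw [Module.finrank_fintype_fun_eq_card, ← hA, Set.ncard_eq_toFinset_card', Set.toFinset_card]
  let b := basisOfLinearIndependentOfCardEqFinrank'
    e (Module.End.eigenvectors_linearIndependent' (toLin' A) _ Subtype.val_injective e he) hcard
  have hb (z : spectrum K A) : toLin' A (b z) = (z : K) • b z := by
    simpa only [b, coe_basisOfLinearIndependentOfCardEqFinrank'] using (he z).apply_eq_smul
  let φ := (toLinAlgEquiv' (R := K) (n := n)).trans (LinearMap.toMatrixAlgEquiv b)
  have hφ : φ A = diagonal (Subtype.val : spectrum K A → K) := by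
    ext y z
    change LinearMap.toMatrixAlgEquiv b (toLin' A) y z = _
    rw [LinearMap.toMatrixAlgEquiv_apply, hb]
    obtain rfl | hyz := eq_or_ne y z
    · simp
    · simp [hyz]
  exact .of_map φ.injective (hφ ▸ hasCommCentralizer_diagonal Subtype.val_injective)

end CommCentralizer

section MatrixAlgebra

variable {n R : Type*} [Fintype n] [CommRing R]

theorem transpose_sub_self_of_isSymm {G₁ G₂ A₁ A₂ : Matrix n n R} (hG₁ : G₁.IsSymm)
    (hG₂ : G₂.IsSymm) (hA₁ : A₁.IsSymm) (hA₂ : A₂.IsSymm) (c₁ c₂ : R) :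
    ((c₁ • (G₁ * A₁) + c₂ • (G₂ * A₂)) * (c₁ • G₁ + c₂ • G₂))ᵀ
        - (c₁ • (G₁ * A₁) + c₂ • (G₂ * A₂)) * (c₁ • G₁ + c₂ • G₂) =
      (c₁ * c₂) • (G₁ * (A₂ - A₁) * G₂ - G₂ * (A₂ - A₁) * G₁) := by
  simp only [transpose_mul, transpose_add, transpose_smul, hG₁.eq, hG₂.eq, hA₁.eq, hA₂.eq,
    Matrix.add_mul, Matrix.mul_add, Matrix.sub_mul, Matrix.mul_sub, Matrix.smul_mul,
    Matrix.mul_smul, Matrix.mul_assoc]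
  module

variable [DecidableEq n]

/-- The matrix form of
`c₁x₁y₁/g₁ + c₂x₂y₂/g₂ - xy/g = c₁c₂ (x₂/g₂ - x₁/g₁) (g₁g₂/g) (y₂/g₂ - y₁/g₁)` for
`x = c₁x₁ + c₂x₂`, `y = c₁y₁ + c₂y₂`, `g = c₁g₁ + c₂g₂`, where `A` stands for `x/g` and
`B` for `y/g`. -/
theorem mul_mul_eq_of_mul_linear {G G₁ G₂ A A₁ A₂ B B₁ B₂ : Matrix n n R} {c₁ c₂ : R}
    (hG : G = c₁ • G₁ + c₂ • G₂) (hdet : IsUnit G.det)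
    (hA : A * G = c₁ • (A₁ * G₁) + c₂ • (A₂ * G₂))
    (hB : G * B = c₁ • (G₁ * B₁) + c₂ • (G₂ * B₂)) :
    A * G * B = c₁ • (A₁ * G₁ * B₁) + c₂ • (A₂ * G₂ * B₂)
      - (c₁ * c₂) • ((A₂ - A₁) * (G₂ * G⁻¹ * G₁) * (B₂ - B₁)) := by
  have hA' : A * G = A₁ * G + c₂ • ((A₂ - A₁) * G₂) := by
    rw [hA, hG, Matrix.mul_add, Matrix.sub_mul, Matrix.mul_smul, Matrix.mul_smul]
    module
  have hB' : B = B₂ - c₁ • (G⁻¹ * (G₁ * (B₂ - B₁))) := by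
    have hGB : G * B = G * B₂ - c₁ • (G₁ * (B₂ - B₁)) := by
      rw [hB, hG, Matrix.add_mul, Matrix.mul_sub, Matrix.smul_mul, Matrix.smul_mul]
      module
    rw [← nonsing_inv_mul_cancel_left G B hdet, hGB, Matrix.mul_sub, Matrix.mul_smul,
      nonsing_inv_mul_cancel_left _ _ hdet]
  calc A * G * B = A₁ * (G * B) + c₂ • ((A₂ - A₁) * G₂ * B) := by
        rw [hA', Matrix.add_mul, Matrix.smul_mul, Matrix.mul_assoc A₁]
    _ = A₁ * (c₁ • (G₁ * B₁) + c₂ • (G₂ * B₂))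
        + c₂ • ((A₂ - A₁) * G₂ * (B₂ - c₁ • (G⁻¹ * (G₁ * (B₂ - B₁))))) := by
        rw [hB, ← hB']
    _ = c₁ • (A₁ * G₁ * B₁) + c₂ • (A₂ * G₂ * B₂)
        - (c₁ * c₂) • ((A₂ - A₁) * (G₂ * G⁻¹ * G₁) * (B₂ - B₁)) := by
        simp only [Matrix.mul_add, Matrix.mul_sub, Matrix.sub_mul, Matrix.mul_smul,
          Matrix.mul_assoc]
        module

theorem mul_inv_mul_comm_of_eq_add_smul {G G₁ G₂ : Matrix n n R} {c₁ c₂ : R}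
    (hG : G = c₁ • G₁ + c₂ • G₂) (hdet : IsUnit G.det) :
    G₁ * G⁻¹ * G₂ = G₂ * G⁻¹ * G₁ := by
  have smul_comm_of {A B : Matrix n n R} {a b : R} (h : G = a • A + b • B) :
      b • (A * G⁻¹ * B - B * G⁻¹ * A) = 0 := by
    have hB : b • B = G - a • A := by rw [h, add_sub_cancel_left]
    rw [smul_sub, ← Matrix.mul_smul, ← Matrix.smul_mul, ← Matrix.smul_mul, hB, Matrix.mul_sub,
      Matrix.sub_mul, Matrix.sub_mul, nonsing_inv_mul_cancel_right _ _ hdet,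
      mul_nonsing_inv _ hdet]
    simp only [Matrix.one_mul, Matrix.smul_mul, Matrix.mul_smul, sub_self]
  set D := G₁ * G⁻¹ * G₂ - G₂ * G⁻¹ * G₁ with hD
  have h₁ : c₁ • D = 0 := by
    rw [hD, ← neg_sub, smul_neg, smul_comm_of (hG.trans (add_comm _ _)), neg_zero]
  have hGD : G * D = 0 := by
    conv_lhs => rw [hG]
    rw [Matrix.add_mul, Matrix.smul_mul, Matrix.smul_mul, ← Matrix.mul_smul, ← Matrix.mul_smul,
      h₁, smul_comm_of hG, Matrix.mul_zero, Matrix.mul_zero, add_zero]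
  rw [← sub_eq_zero, ← hD, ← nonsing_inv_mul_cancel_left G D hdet, hGD, Matrix.mul_zero]

theorem commute_mul_inv {G₁ G₂ X : Matrix n n R} (hdet₂ : IsUnit G₂.det)
    (hX : G₁ * X * G₂ = G₂ * X * G₁) : Commute (G₁ * G₂⁻¹) (G₂ * X) := by
  rw [commute_iff_eq, ← Matrix.mul_assoc, nonsing_inv_mul_cancel_right _ _ hdet₂,
    ← Matrix.mul_assoc, ← hX, mul_nonsing_inv_cancel_right _ _ hdet₂]

theorem HasCommCentralizer.isSymm_mul {G G₁ G₂ S T : Matrix n n R} {c₁ c₂ : R}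
    (hcomm : HasCommCentralizer (G₁ * G₂⁻¹)) (hG : G = c₁ • G₁ + c₂ • G₂) (hdet : IsUnit G.det)
    (hdet₂ : IsUnit G₂.det) (hG₁ : G₁.IsSymm) (hG₂ : G₂.IsSymm) (hS : S.IsSymm) (hT : T.IsSymm)
    (hSG : G₁ * S * G₂ = G₂ * S * G₁) (hTG : G₁ * T * G₂ = G₂ * T * G₁) :
    (S * (G₂ * G⁻¹ * G₁) * T).IsSymm := by
  have hM := mul_inv_mul_comm_of_eq_add_smul hG hdet
  have hGt : G.IsSymm := hG ▸ (hG₁.smul c₁).add (hG₂.smul c₂)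
  set X := G⁻¹ * G₁ * G₂⁻¹ with hX
  have hXG : G₂ * G⁻¹ * G₁ = G₂ * X * G₂ := by
    rw [hX, Matrix.mul_assoc G₂ _ G₂, nonsing_inv_mul_cancel_right _ _ hdet₂, Matrix.mul_assoc]
  have hGX : G₁ * X * G₂ = G₂ * X * G₁ := by
    have h₁ : G₁ * X * G₂ = G₁ * G⁻¹ * G₁ := by
      rw [hX, Matrix.mul_assoc G₁, nonsing_inv_mul_cancel_right _ _ hdet₂, Matrix.mul_assoc]
    have h₂ : G₂ * X * G₁ = G₁ * G⁻¹ * G₁ := by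
      rw [hX, ← Matrix.mul_assoc, ← Matrix.mul_assoc, ← hM, mul_nonsing_inv_cancel_right _ _ hdet₂]
    rw [h₁, h₂]
  have hvS := commute_mul_inv hdet₂ hSG
  have hvT := commute_mul_inv hdet₂ hTG
  have hvX := commute_mul_inv hdet₂ hGX
  have hreverse : G₂ * S * (G₂ * X) * (G₂ * T) = G₂ * T * (G₂ * X) * (G₂ * S) := by
    rw [(hcomm hvS hvX).eq, Matrix.mul_assoc, (hcomm hvS hvT).eq, ← Matrix.mul_assoc,
      (hcomm hvX hvT).eq]
  have hcancel : G₂ * (S * (G₂ * G⁻¹ * G₁) * T) = G₂ * (T * (G₂ * G⁻¹ * G₁) * S) := by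
    simpa only [hXG, Matrix.mul_assoc] using hreverse
  have htranspose : (S * (G₂ * G⁻¹ * G₁) * T)ᵀ = T * (G₂ * G⁻¹ * G₁) * S := by
    simp only [transpose_mul, hS.eq, hT.eq, hG₁.eq, hG₂.eq, hGt.inv.eq, ← hM, Matrix.mul_assoc]
  rw [IsSymm, htranspose, ← nonsing_inv_mul_cancel_left G₂ (T * _ * S) hdet₂, ← hcancel,
    nonsing_inv_mul_cancel_left _ _ hdet₂]

end MatrixAlgebra

section Symmetries

variable {ι K : Type*} [Field K] [CharZero K] {Y : ι → ι → ι → K}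

theorem eq_zero_of_symm_of_skew (hsymm : ∀ i j k, Y i j k = Y i k j)
    (hskew : ∀ i j k, Y i j k = -Y j i k) (i j k : ι) : Y i j k = 0 := by
  have hneg : Y i j k = -Y i j k := calc
    Y i j k = -Y k i j := by rw [hsymm, hskew]
    _ = Y j k i := by rw [hsymm, hskew, neg_neg]
    _ = -Y i j k := by rw [hsymm, hskew]
  exact self_eq_neg.1 hneg

theorem eq_zero_of_skew_of_sum_eq_zero (hskew : ∀ i j k, Y i j k = -Y i k j)
    (hsum : ∀ i j k, Y j i k - Y i j k + Y k i j = 0) (i j k : ι) : Y i j k = 0 := by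
  linear_combination (-1 / 2) * (hsum i j k + hsum k i j) + (1 / 2) * (hskew i j k + hskew j i k)

end Symmetries

variable {N : ℕ} {u : Fin N → ℝ}

section PartialDerivatives

theorem pd_congr {f f' : (Fin N → ℝ) → ℝ} (h : f =ᶠ[𝓝 u] f') (k : Fin N) :
    pd k f u = pd k f' u := by
  rw [pd, pd, h.fderiv_eq]

theorem pd_linear_combination (k : Fin N) (c c' : ℝ) {f f' : (Fin N → ℝ) → ℝ}
    (hf : DifferentiableAt ℝ f u) (hf' : DifferentiableAt ℝ f' u) :
    pd k (fun w => c * f w + c' * f' w) u = c * pd k f u + c' * pd k f' u := by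
  simp only [pd]
  rw [fderiv_fun_add (hf.const_mul c) (hf'.const_mul c'), fderiv_const_mul hf,
    fderiv_const_mul hf']
  rfl

theorem pd_sum_mul {ι : Type*} (s : Finset ι) (k : Fin N) {f f' : ι → (Fin N → ℝ) → ℝ}
    (hf : ∀ i, DifferentiableAt ℝ (f i) u) (hf' : ∀ i, DifferentiableAt ℝ (f' i) u) :
    pd k (fun w => ∑ i ∈ s, f i w * f' i w) u =
      ∑ i ∈ s, (pd k (f i) u * f' i u + f i u * pd k (f' i) u) := by
  simp only [pd]
  rw [fderiv_fun_sum fun i _ => (hf i).fun_mul (hf' i), _root_.sum_apply]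
  refine Finset.sum_congr rfl fun i _ => ?_
  rw [fderiv_fun_mul (hf i) (hf' i)]
  simp only [_root_.add_apply, _root_.smul_apply, smul_eq_mul]
  ring

theorem contDiffAt_pd {f : (Fin N → ℝ) → ℝ} (hf : ContDiffAt ℝ ∞ f u) (k : Fin N) :
    ContDiffAt ℝ ∞ (pd k f) u :=
  (hf.fderiv_right (m := ∞) le_rfl).clm_apply contDiffAt_const

/-- The gradient of the `k`-th row of a matrix field, `∂A^k_j/∂u^s` in row `s` and column `j`. -/
noncomputable def rowGradient (A : MatrixField N) (k : Fin N) (u : Fin N → ℝ) :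
    Matrix (Fin N) (Fin N) ℝ :=
  of fun s j => pd s (fun w => A w k j) u

theorem rowGradient_congr {A B : MatrixField N} (h : A =ᶠ[𝓝 u] B) (k : Fin N) :
    rowGradient A k u = rowGradient B k u := by
  ext s j
  exact pd_congr (h.mono fun w hw => by simp only [hw]) s

theorem rowGradient_const (M : Matrix (Fin N) (Fin N) ℝ) (k : Fin N) :
    rowGradient (fun _ => M) k u = 0 := by
  ext s j
  simp only [rowGradient, pd, of_apply, fderiv_fun_const, Pi.zero_apply, Matrix.zero_apply,
    _root_.zero_apply]

theorem rowGradient_mul {A B : MatrixField N}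
    (hA : ∀ i j, DifferentiableAt ℝ (fun w => A w i j) u)
    (hB : ∀ i j, DifferentiableAt ℝ (fun w => B w i j) u) (k : Fin N) :
    rowGradient (fun w => A w * B w) k u =
      rowGradient A k u * B u + ∑ p, A u k p • rowGradient B p u := by
  ext s j
  simp only [rowGradient, of_apply, mul_apply, Matrix.add_apply, Matrix.sum_apply,
    Matrix.smul_apply, smul_eq_mul]
  rw [pd_sum_mul _ _ (hA k) fun p => hB p j, Finset.sum_add_distrib]

end PartialDerivatives

section Smoothness

variable {A : MatrixField N}

theorem contDiffAt_det (hA : ∀ i j, ContDiffAt ℝ ∞ (fun w => A w i j) u) :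
    ContDiffAt ℝ ∞ (fun w => (A w).det) u := by
  simp only [det_apply']
  exact ContDiffAt.sum fun σ _ => contDiffAt_const.mul (contDiffAt_prod fun i _ => hA _ _)

theorem contDiffAt_inv (hA : ∀ i j, ContDiffAt ℝ ∞ (fun w => A w i j) u)
    (hdet : (A u).det ≠ 0) (i j : Fin N) : ContDiffAt ℝ ∞ (fun w => (A w)⁻¹ i j) u := by
  simp only [inv_def, Ring.inverse_eq_inv', Matrix.smul_apply, smul_eq_mul, adjugate_apply]
  refine ((contDiffAt_det hA).inv hdet).mul (contDiffAt_det fun a b => ?_)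
  simp only [updateRow_apply]
  split_ifs
  · exact contDiffAt_const
  · exact hA a b

end Smoothness

/-- The symmetric matrix `(Γ^j_{sk})_{sk}` of the Levi-Civita coefficients with upper index `j`. -/
noncomputable def christoffelMatrix (g : MatrixField N) (j : Fin N) (u : Fin N → ℝ) :
    Matrix (Fin N) (Fin N) ℝ :=
  of fun s k => christoffel g j s k u

theorem christoffelUp_eq_mul (g : MatrixField N) (i j k : Fin N) :
    christoffelUp g i j k u = (g u * christoffelMatrix g j u) i k := rfl

namespace IsMetricOn

variable {U : Set (Fin N → ℝ)} {g : MatrixField N}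

theorem isUnit_det (h : IsMetricOn U g) (hu : u ∈ U) : IsUnit (g u).det :=
  (h.nondegenerate u hu).isUnit

theorem contDiffAt (h : IsMetricOn U g) (hU : U ∈ 𝓝 u) (i j : Fin N) :
    ContDiffAt ℝ ∞ (fun w => g w i j) u :=
  (h.smooth i j).contDiffAt hU

theorem contDiffAt_inv (h : IsMetricOn U g) (hU : U ∈ 𝓝 u) (i j : Fin N) :
    ContDiffAt ℝ ∞ (fun w => (g w)⁻¹ i j) u :=
  MetricPencil.contDiffAt_inv (h.contDiffAt hU) (h.nondegenerate u (mem_of_mem_nhds hU)) i j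

theorem differentiableAt (h : IsMetricOn U g) (hU : U ∈ 𝓝 u) (i j : Fin N) :
    DifferentiableAt ℝ (fun w => g w i j) u :=
  (h.contDiffAt hU i j).differentiableAt (by simp)

theorem differentiableAt_inv (h : IsMetricOn U g) (hU : U ∈ 𝓝 u) (i j : Fin N) :
    DifferentiableAt ℝ (fun w => (g w)⁻¹ i j) u :=
  (h.contDiffAt_inv hU i j).differentiableAt (by simp)

theorem differentiableAt_christoffel (h : IsMetricOn U g) (hU : U ∈ 𝓝 u) (i j k : Fin N) :
    DifferentiableAt ℝ (christoffel g i j k) u := by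
  have hpd (a b c : Fin N) : ContDiffAt ℝ ∞ (pd a fun w => (g w)⁻¹ b c) u :=
    contDiffAt_pd (h.contDiffAt_inv hU b c) a
  have hsmooth : ContDiffAt ℝ ∞ (christoffel g i j k) u :=
    contDiffAt_const.mul <| ContDiffAt.sum fun s _ =>
      (h.contDiffAt hU i s).mul (((hpd j s k).add (hpd k j s)).sub (hpd s j k))
  exact hsmooth.differentiableAt (by simp)

theorem differentiableAt_christoffelUp (h : IsMetricOn U g) (hU : U ∈ 𝓝 u) (i j k : Fin N) :
    DifferentiableAt ℝ (christoffelUp g i j k) u :=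
  DifferentiableAt.fun_sum fun s _ =>
    (h.differentiableAt hU i s).fun_mul (h.differentiableAt_christoffel hU j s k)

theorem pd_inv_comm (h : IsMetricOn U g) (hU : U ∈ 𝓝 u) (k i j : Fin N) :
    pd k (fun w => (g w)⁻¹ i j) u = pd k (fun w => (g w)⁻¹ j i) u :=
  pd_congr (Filter.eventually_of_mem hU fun w hw => (h.symm w hw).inv.apply j i) k

theorem isSymm_christoffelMatrix (h : IsMetricOn U g) (hU : U ∈ 𝓝 u) (j : Fin N) :
    (christoffelMatrix g j u).IsSymm := IsSymm.ext fun a b => by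
  simp only [christoffelMatrix, of_apply, christoffel]
  congr! 3 with s
  rw [h.pd_inv_comm hU b s a, h.pd_inv_comm hU a b s, h.pd_inv_comm hU s b a]
  ring

theorem christoffelMatrix_mul (h : IsMetricOn U g) (hU : U ∈ 𝓝 u) (j : Fin N) :
    christoffelMatrix g j u * g u = (g u * christoffelMatrix g j u)ᵀ := by
  rw [transpose_mul, (h.isSymm_christoffelMatrix hU j).eq, (h.symm u (mem_of_mem_nhds hU)).eq]

theorem rowGradient_eq_inv (h : IsMetricOn U g) (hU : U ∈ 𝓝 u) (i : Fin N) :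
    rowGradient g i u = -((∑ p, g u i p • rowGradient (fun w => (g w)⁻¹) p u) * g u) := by
  have hconst : rowGradient (fun w => g w * (g w)⁻¹) i u = 0 := by
    rw [rowGradient_congr (B := fun _ => 1) (Filter.eventually_of_mem hU fun w hw =>
      mul_nonsing_inv _ (h.isUnit_det hw)) i, rowGradient_const]
  rw [rowGradient_mul (h.differentiableAt hU) (h.differentiableAt_inv hU)] at hconst
  rw [← nonsing_inv_mul_cancel_right _ (rowGradient g i u) (h.isUnit_det (mem_of_mem_nhds hU)),
    eq_neg_of_add_eq_zero_left hconst, Matrix.neg_mul]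

theorem pd_eq (h : IsMetricOn U g) (hU : U ∈ 𝓝 u) (i j k : Fin N) :
    pd k (fun w => g w i j) u = -(christoffelUp g i j k u + christoffelUp g j i k u) := by
  have hup (a b : Fin N) : christoffelUp g a b k u = ∑ s, ∑ t, g u a s * g u b t * ((1 / 2) *
      (pd s (fun w => (g w)⁻¹ t k) u + pd k (fun w => (g w)⁻¹ s t) u
        - pd t (fun w => (g w)⁻¹ s k) u)) := by
    simp only [christoffelUp, christoffel, Finset.mul_sum]
    exact Finset.sum_congr rfl fun s _ => Finset.sum_congr rfl fun t _ => by ring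
  have hgrad := congrFun₂ (h.rowGradient_eq_inv hU i) k j
  simp only [rowGradient, of_apply, Matrix.neg_apply, mul_apply, Matrix.sum_apply,
    Matrix.smul_apply, smul_eq_mul, Finset.sum_mul] at hgrad
  rw [hgrad, neg_inj, hup i j, hup j i, Finset.sum_comm (f := fun s t => g u j s * g u i t * _),
    ← Finset.sum_add_distrib]
  refine Finset.sum_congr rfl fun s _ => ?_
  rw [← Finset.sum_add_distrib]
  refine Finset.sum_congr rfl fun t _ => ?_
  rw [h.pd_inv_comm hU k t s, (h.symm u (mem_of_mem_nhds hU)).apply j t]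
  ring

theorem rowGradient_eq (h : IsMetricOn U g) (hU : U ∈ 𝓝 u) (k : Fin N) :
    rowGradient g k u = -(christoffelMatrix g k u * g u
      + of fun s b => (g u * christoffelMatrix g b u) k s) := by
  ext s b
  simp only [rowGradient, of_apply, Matrix.neg_apply, Matrix.add_apply,
    h.christoffelMatrix_mul hU, transpose_apply, h.pd_eq hU k b s, christoffelUp_eq_mul]
  ring

/-- The part of `R^{ij}_{kl}` that yields the whole by alternation in `k` and `l`. -/
theorem sum_mul_pd_christoffel_sub (h : IsMetricOn U g) (hU : U ∈ 𝓝 u) (i j k l : Fin N) :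
    ∑ s, g u i s * (pd k (christoffel g j s l) u
        - ∑ p, christoffel g j p l u * christoffel g p s k u) =
      pd k (christoffelUp g i j l) u
        + (christoffelMatrix g i u * g u * christoffelMatrix g j u) k l := by
  have hquad : (christoffelMatrix g i u * g u * christoffelMatrix g j u) k l =
      ∑ s, christoffelUp g s i k u * christoffel g j s l u := by
    rw [h.christoffelMatrix_mul hU]
    rfl
  have hswap : ∑ s, g u i s * ∑ p, christoffel g j p l u * christoffel g p s k u =
      ∑ s, christoffelUp g i s k u * christoffel g j s l u := by
    simp only [Finset.mul_sum, christoffelUp, Finset.sum_mul]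
    rw [Finset.sum_comm]
    exact Finset.sum_congr rfl fun p _ => Finset.sum_congr rfl fun s _ => by ring
  have hleibniz : pd k (christoffelUp g i j l) u =
      ∑ s, (pd k (fun w => g w i s) u * christoffel g j s l u
        + g u i s * pd k (christoffel g j s l) u) :=
    pd_sum_mul _ k (h.differentiableAt hU i) fun s => h.differentiableAt_christoffel hU j s l
  simp only [mul_sub, Finset.sum_sub_distrib, hswap, hleibniz, hquad, h.pd_eq hU]
  rw [← Finset.sum_sub_distrib, ← Finset.sum_add_distrib]
  exact Finset.sum_congr rfl fun s _ => by ring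

theorem riemannUp_eq (h : IsMetricOn U g) (hU : U ∈ 𝓝 u) (i j k l : Fin N) :
    riemannUp g i j k l u =
      pd k (christoffelUp g i j l) u - pd l (christoffelUp g i j k) u
        + (christoffelMatrix g i u * g u * christoffelMatrix g j u) k l
        - (christoffelMatrix g i u * g u * christoffelMatrix g j u) l k := by
  have hskew : riemannUp g i j k l u =
      ∑ s, g u i s * (pd k (christoffel g j s l) u
          - ∑ p, christoffel g j p l u * christoffel g p s k u)
        - ∑ s, g u i s * (pd l (christoffel g j s k) u
          - ∑ p, christoffel g j p k u * christoffel g p s l u) := by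
    rw [riemannUp, ← Finset.sum_sub_distrib]
    exact Finset.sum_congr rfl fun s _ => by rw [riemann]; ring
  rw [hskew, h.sum_mul_pd_christoffel_sub hU, h.sum_mul_pd_christoffel_sub hU]
  ring

end IsMetricOn

section Connection

theorem IsMetricOn.eq_mul_christoffelMatrix {U : Set (Fin N → ℝ)} {g : MatrixField N}
    (h : IsMetricOn U g) (hU : U ∈ 𝓝 u) {C : Fin N → Matrix (Fin N) (Fin N) ℝ}
    (hsymm : ∀ j, (C j * g u).IsSymm)
    (hmetric : ∀ i j k, pd k (fun w => g w i j) u = -(C j i k + C i j k)) (j : Fin N) :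
    C j = g u * christoffelMatrix g j u := by
  have hu := mem_of_mem_nhds hU
  set D : Fin N → Matrix (Fin N) (Fin N) ℝ := fun j => C j - g u * christoffelMatrix g j u
    with hD
  have hDsymm (j : Fin N) : (D j * g u).IsSymm := by
    rw [hD, Matrix.sub_mul]
    refine (hsymm j).sub ?_
    simp only [IsSymm, transpose_mul, (h.symm u hu).eq, (h.isSymm_christoffelMatrix hU j).eq,
      Matrix.mul_assoc]
  have hDskew (j i k : Fin N) : D j i k = -D i j k := by
    have hsum := (hmetric i j k).symm.trans (h.pd_eq hU i j k)
    simp only [christoffelUp_eq_mul] at hsum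
    simp only [hD, Matrix.sub_apply]
    linear_combination -hsum
  have hDg : D j * g u = 0 := by
    ext i k
    refine eq_zero_of_symm_of_skew (Y := fun j i k => (D j * g u) i k)
      (fun j i k => (hDsymm j).apply k i) (fun j i k => ?_) j i k
    simp only [mul_apply, hDskew j i, neg_mul, Finset.sum_neg_distrib]
  rw [← sub_eq_zero, ← mul_nonsing_inv_cancel_right _ (C j - _) (h.isUnit_det hu)]
  exact (congrArg (· * (g u)⁻¹) hDg).trans (Matrix.zero_mul _)

/-- The matrix `(S^j_{sk})_{sk}` of the difference tensor `S = Γ₂ - Γ₁` of two Levi-Civita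
connections. -/
noncomputable def connectionDifference (g₁ g₂ : MatrixField N) (j : Fin N) (u : Fin N → ℝ) :
    Matrix (Fin N) (Fin N) ℝ :=
  christoffelMatrix g₂ j u - christoffelMatrix g₁ j u

/-- The skew matrix `g₁^{is} S^j_{sp} g₂^{pk} - g₂^{is} S^j_{sp} g₁^{pk}` obstructing the almost
compatibility of `g₁` and `g₂`, where `S = Γ₂ - Γ₁`. -/
noncomputable def pencilDefect (g₁ g₂ : MatrixField N) (j : Fin N) (u : Fin N → ℝ) :
    Matrix (Fin N) (Fin N) ℝ :=
  g₁ u * connectionDifference g₁ g₂ j u * g₂ u - g₂ u * connectionDifference g₁ g₂ j u * g₁ u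

theorem connectionLinearAt_iff_matrix {g₁ g₂ : MatrixField N} {c₁ c₂ : ℝ} :
    ConnectionLinearAt c₁ c₂ g₁ g₂ u ↔ ∀ j,
      combination c₁ c₂ g₁ g₂ u * christoffelMatrix (combination c₁ c₂ g₁ g₂) j u =
        c₁ • (g₁ u * christoffelMatrix g₁ j u) + c₂ • (g₂ u * christoffelMatrix g₂ j u) :=
  ⟨fun h j => Matrix.ext fun i k => h i j k, fun h i j k => congrFun₂ (h j) i k⟩

theorem exists_combination_det_ne_zero {g₁ g₂ : MatrixField N} (h : (g₂ u).det ≠ 0) :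
    ∃ c : ℝ, c ≠ 0 ∧ (combination c 1 g₁ g₂ u).det ≠ 0 := by
  have hcont : Continuous fun c : ℝ => (combination c 1 g₁ g₂ u).det := by
    unfold combination
    fun_prop
  have hzero : (combination 0 1 g₁ g₂ u).det ≠ 0 := by
    rwa [combination, zero_smul, one_smul, zero_add]
  have hnear : ∀ᶠ c : ℝ in 𝓝[≠] 0, (combination c 1 g₁ g₂ u).det ≠ 0 :=
    (hcont.continuousAt.eventually_ne hzero).filter_mono nhdsWithin_le_nhds
  have hne : ∀ᶠ c : ℝ in 𝓝[≠] 0, c ≠ 0 := self_mem_nhdsWithin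
  exact (hne.and hnear).exists

variable {U : Set (Fin N → ℝ)} {g₁ g₂ : MatrixField N} {c₁ c₂ : ℝ}

theorem isMetricOn_combination (h₁ : IsMetricOn U g₁) (h₂ : IsMetricOn U g₂) (c₁ c₂ : ℝ) :
    IsMetricOn {w ∈ U | (combination c₁ c₂ g₁ g₂ w).det ≠ 0} (combination c₁ c₂ g₁ g₂) where
  smooth i j := ((contDiffOn_const.mul (h₁.smooth i j)).add
    (contDiffOn_const.mul (h₂.smooth i j))).mono (Set.sep_subset _ _)
  symm w hw := ((h₁.symm w hw.1).smul c₁).add ((h₂.symm w hw.1).smul c₂)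
  nondegenerate _ hw := hw.2

theorem setOf_combination_det_ne_zero_mem_nhds (h₁ : IsMetricOn U g₁) (h₂ : IsMetricOn U g₂)
    (hU : U ∈ 𝓝 u) (hdet : (combination c₁ c₂ g₁ g₂ u).det ≠ 0) :
    {w ∈ U | (combination c₁ c₂ g₁ g₂ w).det ≠ 0} ∈ 𝓝 u :=
  Filter.inter_mem hU <| (contDiffAt_det fun i j =>
    (contDiffAt_const.mul (h₁.contDiffAt hU i j)).add
      (contDiffAt_const.mul (h₂.contDiffAt hU i j))).continuousAt.eventually_ne hdet

theorem isSymm_connectionDifference (h₁ : IsMetricOn U g₁) (h₂ : IsMetricOn U g₂)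
    (hU : U ∈ 𝓝 u) (j : Fin N) : (connectionDifference g₁ g₂ j u).IsSymm :=
  (h₂.isSymm_christoffelMatrix hU j).sub (h₁.isSymm_christoffelMatrix hU j)

theorem pencilDefect_skew (h₁ : IsMetricOn U g₁) (h₂ : IsMetricOn U g₂) (hU : U ∈ 𝓝 u)
    (j a b : Fin N) : pencilDefect g₁ g₂ j u a b = -pencilDefect g₁ g₂ j u b a := by
  have hu := mem_of_mem_nhds hU
  have htranspose : (pencilDefect g₁ g₂ j u)ᵀ = -pencilDefect g₁ g₂ j u := by
    simp only [pencilDefect, transpose_sub, transpose_mul, (h₁.symm u hu).eq, (h₂.symm u hu).eq,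
      (isSymm_connectionDifference h₁ h₂ hU j).eq, Matrix.mul_assoc, neg_sub]
  exact congrFun₂ htranspose b a

theorem connectionLinearAt_iff_smul_pencilDefect (h₁ : IsMetricOn U g₁) (h₂ : IsMetricOn U g₂)
    (hU : U ∈ 𝓝 u) (hdet : (combination c₁ c₂ g₁ g₂ u).det ≠ 0) :
    ConnectionLinearAt c₁ c₂ g₁ g₂ u ↔ ∀ j, (c₁ * c₂) • pencilDefect g₁ g₂ j u = 0 := by
  have hu := mem_of_mem_nhds hU
  have h := isMetricOn_combination h₁ h₂ c₁ c₂
  have hV := setOf_combination_det_ne_zero_mem_nhds h₁ h₂ hU hdet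
  set C : Fin N → Matrix (Fin N) (Fin N) ℝ := fun j =>
    c₁ • (g₁ u * christoffelMatrix g₁ j u) + c₂ • (g₂ u * christoffelMatrix g₂ j u) with hC
  have hskew (j : Fin N) : (C j * combination c₁ c₂ g₁ g₂ u)ᵀ - C j * combination c₁ c₂ g₁ g₂ u =
      (c₁ * c₂) • pencilDefect g₁ g₂ j u :=
    transpose_sub_self_of_isSymm (h₁.symm u hu) (h₂.symm u hu)
      (h₁.isSymm_christoffelMatrix hU j) (h₂.isSymm_christoffelMatrix hU j) c₁ c₂
  have hmetric (i j k : Fin N) :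
      pd k (fun w => combination c₁ c₂ g₁ g₂ w i j) u = -(C j i k + C i j k) := by
    have hpd : pd k (fun w => combination c₁ c₂ g₁ g₂ w i j) u =
        c₁ * pd k (fun w => g₁ w i j) u + c₂ * pd k (fun w => g₂ w i j) u :=
      pd_linear_combination k c₁ c₂ (h₁.differentiableAt hU i j) (h₂.differentiableAt hU i j)
    rw [hpd, h₁.pd_eq hU, h₂.pd_eq hU]
    simp only [hC, christoffelUp_eq_mul, Matrix.add_apply, Matrix.smul_apply, smul_eq_mul]
    ring
  rw [connectionLinearAt_iff_matrix]
  constructor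
  · intro hlin j
    have hCj : C j = _ := (hlin j).symm
    rw [← hskew, hCj]
    simp only [transpose_mul, (h.symm u (mem_of_mem_nhds hV)).eq,
      (h.isSymm_christoffelMatrix hV j).eq, Matrix.mul_assoc, sub_self]
  · intro hQ j
    exact (h.eq_mul_christoffelMatrix hV
      (fun j => sub_eq_zero.1 ((hskew j).trans (hQ j))) hmetric j).symm

theorem almostCompatible_iff_pencilDefect (hU : IsOpen U) (h₁ : IsMetricOn U g₁)
    (h₂ : IsMetricOn U g₂) :
    AlmostCompatible U g₁ g₂ ↔ ∀ u ∈ U, ∀ j, pencilDefect g₁ g₂ j u = 0 := by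
  constructor
  · intro h u hu j
    obtain ⟨c, hc, hdet⟩ := exists_combination_det_ne_zero (g₁ := g₁) (h₂.nondegenerate u hu)
    have hQ := (connectionLinearAt_iff_smul_pencilDefect h₁ h₂ (hU.mem_nhds hu) hdet).1
      (h c 1 u hu hdet) j
    exact (smul_eq_zero.1 hQ).resolve_left (mul_ne_zero hc one_ne_zero)
  · intro h c₁ c₂ u hu hdet
    refine (connectionLinearAt_iff_smul_pencilDefect h₁ h₂ (hU.mem_nhds hu) hdet).2 fun j => ?_
    rw [h u hu j, smul_zero]

end Connection

section Nijenhuis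

variable {n R : Type*} [Fintype n] [CommRing R]

/-- The Nijenhuis tensor `N^k_{ij}`, with `k` fixed, as an expression in an affinor `A` and its
gradient `W`, where `W k` holds `∂A^k_j/∂u^s` in row `s` and column `j`. -/
def nijenhuisForm (A : Matrix n n R) (W : n → Matrix n n R) (k : n) : Matrix n n R :=
  Aᵀ * W k - (W k)ᵀ * A - ∑ s, A k s • (W s - (W s)ᵀ)

/-- Partial derivatives in the Nijenhuis tensor may be replaced by covariant derivatives with
respect to any torsion-free connection `Γ`. -/
theorem nijenhuisForm_add_connection (A : Matrix n n R) (W : n → Matrix n n R)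
    {Γ : n → Matrix n n R} (hΓ : ∀ k, (Γ k).IsSymm) (k : n) :
    nijenhuisForm A (fun k => W k + Γ k * A - ∑ p, A k p • Γ p) k = nijenhuisForm A W k := by
  simp only [nijenhuisForm, transpose_sub, transpose_add, transpose_mul, transpose_sum,
    transpose_smul, (hΓ _).eq, smul_add, smul_sub, Finset.sum_add_distrib,
    Finset.sum_sub_distrib, Matrix.mul_add, Matrix.mul_sub, Matrix.add_mul, Matrix.sub_mul,
    Matrix.mul_sum, Matrix.sum_mul, Matrix.mul_smul, Matrix.smul_mul, Matrix.mul_assoc]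
  abel

theorem mul_nijenhuisForm_mul_apply {G₁ G₂ A : Matrix n n R} {S W : n → Matrix n n R}
    (hG₁ : G₁.IsSymm) (hG₂ : G₂.IsSymm) (hS : ∀ k, (S k).IsSymm) (hA : A * G₂ = G₁)
    (hW : ∀ k, W k * G₂ = S k * G₁ + of fun s b => (G₁ * S b) k s) (k a b : n) :
    (G₂ * nijenhuisForm A W k * G₂) a b = ∑ q, A k q *
      ((G₁ * S b * G₂ - G₂ * S b * G₁) a q - (G₁ * S a * G₂ - G₂ * S a * G₁) b q
        + (G₁ * S q * G₂ - G₂ * S q * G₁) a b) := by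
  have hAt : G₂ * Aᵀ = G₁ := by rw [← hG₁.eq, ← hA, transpose_mul, hG₂.eq]
  have hswap {H K : Matrix n n R} (hH : H.IsSymm) (hK : K.IsSymm) (j x y : n) :
      (H * S j * K) x y = (K * S j * H) y x := by
    rw [← transpose_apply (H * S j * K), transpose_mul, transpose_mul, hH.eq, hK.eq, (hS j).eq,
      Matrix.mul_assoc]
  have hHW {H : Matrix n n R} (hH : H.IsSymm) (q x y : n) :
      (H * (W q * G₂)) x y = (H * S q * G₁) x y + (G₁ * S y * H) q x := by
    rw [hW, Matrix.mul_add, ← Matrix.mul_assoc, Matrix.add_apply, mul_apply (N := H)]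
    simp only [mul_apply (M := H), of_apply, hH.apply _ x, mul_comm]
  have hdecomp : G₂ * nijenhuisForm A W k * G₂ =
      G₁ * (W k * G₂) - (G₁ * (W k * G₂))ᵀ
        - ∑ q, A k q • (G₂ * (W q * G₂) - (G₂ * (W q * G₂))ᵀ) := by
    simp only [nijenhuisForm, ← hAt, transpose_mul, transpose_transpose, hG₂.eq,
      Matrix.mul_sub, Matrix.sub_mul, Matrix.mul_sum, Matrix.sum_mul, Matrix.mul_smul,
      Matrix.smul_mul, Matrix.mul_assoc]
  have hG₁S (j x : n) : (G₁ * S j * G₁) k x = ∑ q, A k q * (G₂ * S j * G₁) q x := by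
    rw [← mul_apply, ← Matrix.mul_assoc, ← Matrix.mul_assoc, hA]
  rw [hdecomp]
  simp only [Matrix.sub_apply, transpose_apply, Matrix.sum_apply, Matrix.smul_apply, smul_eq_mul,
    hHW hG₁, hHW hG₂, hG₁S]
  rw [hswap hG₁ hG₁ k b a, add_sub_add_left_eq_sub, ← Finset.sum_sub_distrib,
    ← Finset.sum_sub_distrib]
  refine Finset.sum_congr rfl fun q _ => ?_
  rw [hswap hG₁ hG₂ b a q, hswap hG₂ hG₁ b a q, hswap hG₁ hG₂ a b q, hswap hG₂ hG₁ a b q,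
    hswap hG₂ hG₁ q b a]
  ring

theorem nijenhuis_eq_nijenhuisForm (v : MatrixField N) (k i j : Fin N) :
    nijenhuis v k i j u = nijenhuisForm (v u) (fun k => rowGradient v k u) k i j := by
  simp only [nijenhuis, nijenhuisForm, rowGradient, Matrix.sub_apply, mul_apply, transpose_apply,
    of_apply, Matrix.sum_apply, Matrix.smul_apply, smul_eq_mul, mul_sub, Finset.sum_sub_distrib,
    Finset.sum_add_distrib]
  simp only [mul_comm (v u _ j)]
  ring

variable {U : Set (Fin N → ℝ)} {g₁ g₂ : MatrixField N}

theorem affinor_mul (h₂ : IsMetricOn U g₂) (hu : u ∈ U) : affinor g₁ g₂ u * g₂ u = g₁ u :=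
  nonsing_inv_mul_cancel_right _ _ (h₂.isUnit_det hu)

theorem rowGradient_affinor_mul (h₁ : IsMetricOn U g₁) (h₂ : IsMetricOn U g₂) (hU : U ∈ 𝓝 u)
    (k : Fin N) :
    (rowGradient (affinor g₁ g₂) k u + christoffelMatrix g₂ k u * affinor g₁ g₂ u
        - ∑ p, affinor g₁ g₂ u k p • christoffelMatrix g₂ p u) * g₂ u =
      connectionDifference g₁ g₂ k u * g₁ u
        + of fun s b => (g₁ u * connectionDifference g₁ g₂ b u) k s := by
  have hu := mem_of_mem_nhds hU
  have hdiff (i j : Fin N) : DifferentiableAt ℝ (fun w => affinor g₁ g₂ w i j) u := by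
    simp only [affinor, mul_apply]
    exact DifferentiableAt.fun_sum fun s _ =>
      (h₁.differentiableAt hU i s).fun_mul (h₂.differentiableAt_inv hU s j)
  have hprod : rowGradient (affinor g₁ g₂) k u * g₂ u +
      ∑ p, affinor g₁ g₂ u k p • rowGradient g₂ p u = rowGradient g₁ k u := by
    rw [← rowGradient_mul hdiff (h₂.differentiableAt hU)]
    exact rowGradient_congr (Filter.eventually_of_mem hU fun w hw => affinor_mul h₂ hw) k
  have hsum : ∑ p, affinor g₁ g₂ u k p • rowGradient g₂ p u =
      -((∑ p, affinor g₁ g₂ u k p • christoffelMatrix g₂ p u) * g₂ u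
        + of fun s b => (g₁ u * christoffelMatrix g₂ b u) k s) := by
    have hup : ∑ p, affinor g₁ g₂ u k p • (of fun s b => (g₂ u * christoffelMatrix g₂ b u) p s) =
        of fun s b => (g₁ u * christoffelMatrix g₂ b u) k s := by
      ext s b
      simp only [Matrix.sum_apply, Matrix.smul_apply, of_apply, smul_eq_mul]
      rw [← mul_apply, ← Matrix.mul_assoc, affinor_mul h₂ hu]
    simp only [h₂.rowGradient_eq hU, smul_neg, smul_add, Finset.sum_neg_distrib,
      Finset.sum_add_distrib, hup, Matrix.sum_mul, Matrix.smul_mul]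
  rw [Matrix.sub_mul, Matrix.add_mul, Matrix.mul_assoc _ (affinor g₁ g₂ u), affinor_mul h₂ hu,
    eq_sub_of_add_eq hprod, hsum, h₁.rowGradient_eq hU]
  ext s b
  simp only [connectionDifference, Matrix.sub_mul, Matrix.mul_sub, Matrix.add_apply,
    Matrix.sub_apply, Matrix.neg_apply, of_apply]
  ring

theorem det_affinor_ne_zero (h₁ : IsMetricOn U g₁) (h₂ : IsMetricOn U g₂) (hu : u ∈ U) :
    (affinor g₁ g₂ u).det ≠ 0 := by
  refine left_ne_zero_of_mul (b := (g₂ u).det) ?_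
  rw [← det_mul, affinor_mul h₂ hu]
  exact h₁.nondegenerate u hu

theorem mul_nijenhuisForm_affinor_mul_apply (h₁ : IsMetricOn U g₁) (h₂ : IsMetricOn U g₂)
    (hU : U ∈ 𝓝 u) (k a b : Fin N) :
    (g₂ u * nijenhuisForm (affinor g₁ g₂ u) (fun k => rowGradient (affinor g₁ g₂) k u) k
        * g₂ u) a b =
      ∑ q, affinor g₁ g₂ u k q * (pencilDefect g₁ g₂ b u a q - pencilDefect g₁ g₂ a u b q
        + pencilDefect g₁ g₂ q u a b) := by
  have hu := mem_of_mem_nhds hU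
  rw [← nijenhuisForm_add_connection _ _ (h₂.isSymm_christoffelMatrix hU)]
  exact mul_nijenhuisForm_mul_apply (h₁.symm u hu) (h₂.symm u hu)
    (isSymm_connectionDifference h₁ h₂ hU) (affinor_mul h₂ hu)
    (rowGradient_affinor_mul h₁ h₂ hU) k a b

theorem nijenhuis_affinor_eq_zero_iff (h₁ : IsMetricOn U g₁) (h₂ : IsMetricOn U g₂)
    (hU : U ∈ 𝓝 u) :
    (∀ k i j, nijenhuis (affinor g₁ g₂) k i j u = 0) ↔ ∀ j, pencilDefect g₁ g₂ j u = 0 := by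
  have hu := mem_of_mem_nhds hU
  have hcontract := mul_nijenhuisForm_affinor_mul_apply h₁ h₂ hU
  simp only [nijenhuis_eq_nijenhuisForm]
  set 𝒩 := nijenhuisForm (affinor g₁ g₂ u) fun k => rowGradient (affinor g₁ g₂) k u
  constructor
  · intro h𝒩
    have hsum (a b : Fin N) : (fun q => pencilDefect g₁ g₂ b u a q
        - pencilDefect g₁ g₂ a u b q + pencilDefect g₁ g₂ q u a b) = 0 := by
      refine eq_zero_of_mulVec_eq_zero (det_affinor_ne_zero h₁ h₂ hu) (funext fun k => ?_)
      have h𝒩k : 𝒩 k = 0 := Matrix.ext (h𝒩 k)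
      refine (hcontract k a b).symm.trans ?_
      rw [h𝒩k, Matrix.mul_zero, Matrix.zero_mul, Matrix.zero_apply, Pi.zero_apply]
    exact fun j => Matrix.ext fun a b => eq_zero_of_skew_of_sum_eq_zero
      (Y := fun j a b => pencilDefect g₁ g₂ j u a b)
      (pencilDefect_skew h₁ h₂ hU) (fun a b q => congrFun (hsum a b) q) j a b
  · intro hQ k i j
    have hg𝒩g : g₂ u * 𝒩 k * g₂ u = 0 := Matrix.ext fun a b => by
      simp only [hcontract, hQ, Matrix.zero_apply, sub_zero, add_zero, mul_zero,
        Finset.sum_const_zero]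
    have hdet := h₂.isUnit_det hu
    rw [← nonsing_inv_mul_cancel_left (g₂ u) (𝒩 k) hdet,
      ← mul_nonsing_inv_cancel_right (g₂ u) (g₂ u * 𝒩 k) hdet, hg𝒩g, Matrix.zero_mul,
      Matrix.mul_zero, Matrix.zero_apply]

end Nijenhuis

section Curvature

variable {U : Set (Fin N → ℝ)} {g₁ g₂ : MatrixField N} {c₁ c₂ : ℝ}

theorem pd_christoffelUp_combination (h₁ : IsMetricOn U g₁) (h₂ : IsMetricOn U g₂)
    (hU : U ∈ 𝓝 u) (hlin : ∀ᶠ w in 𝓝 u, ConnectionLinearAt c₁ c₂ g₁ g₂ w) (i j k l : Fin N) :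
    pd k (christoffelUp (combination c₁ c₂ g₁ g₂) i j l) u =
      c₁ * pd k (christoffelUp g₁ i j l) u + c₂ * pd k (christoffelUp g₂ i j l) u := by
  rw [← pd_linear_combination k c₁ c₂ (h₁.differentiableAt_christoffelUp hU i j l)
    (h₂.differentiableAt_christoffelUp hU i j l)]
  exact pd_congr (hlin.mono fun w hw => hw i j l) k

theorem ConnectionLinearAt.christoffelMatrix_mul_mul (h₁ : IsMetricOn U g₁)
    (h₂ : IsMetricOn U g₂) (hU : U ∈ 𝓝 u) (hdet : (combination c₁ c₂ g₁ g₂ u).det ≠ 0)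
    (hlin : ConnectionLinearAt c₁ c₂ g₁ g₂ u) (i j : Fin N) :
    christoffelMatrix (combination c₁ c₂ g₁ g₂) i u * combination c₁ c₂ g₁ g₂ u
        * christoffelMatrix (combination c₁ c₂ g₁ g₂) j u =
      c₁ • (christoffelMatrix g₁ i u * g₁ u * christoffelMatrix g₁ j u)
        + c₂ • (christoffelMatrix g₂ i u * g₂ u * christoffelMatrix g₂ j u)
        - (c₁ * c₂) • (connectionDifference g₁ g₂ i u
          * (g₂ u * (combination c₁ c₂ g₁ g₂ u)⁻¹ * g₁ u) * connectionDifference g₁ g₂ j u) := by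
  have hΓ := connectionLinearAt_iff_matrix.1 hlin
  refine mul_mul_eq_of_mul_linear rfl hdet.isUnit ?_ (hΓ j)
  rw [(isMetricOn_combination h₁ h₂ c₁ c₂).christoffelMatrix_mul
      (setOf_combination_det_ne_zero_mem_nhds h₁ h₂ hU hdet), hΓ i, transpose_add,
    transpose_smul, transpose_smul, h₁.christoffelMatrix_mul hU, h₂.christoffelMatrix_mul hU]

theorem curvatureLinearAt_of_isSymm (h₁ : IsMetricOn U g₁) (h₂ : IsMetricOn U g₂)
    (hU : U ∈ 𝓝 u) (hdet : (combination c₁ c₂ g₁ g₂ u).det ≠ 0)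
    (hlin : ∀ᶠ w in 𝓝 u, ConnectionLinearAt c₁ c₂ g₁ g₂ w)
    (hsymm : ∀ i j, (connectionDifference g₁ g₂ i u
      * (g₂ u * (combination c₁ c₂ g₁ g₂ u)⁻¹ * g₁ u) * connectionDifference g₁ g₂ j u).IsSymm) :
    CurvatureLinearAt c₁ c₂ g₁ g₂ u := by
  intro i j k l
  rw [(isMetricOn_combination h₁ h₂ c₁ c₂).riemannUp_eq
      (setOf_combination_det_ne_zero_mem_nhds h₁ h₂ hU hdet), h₁.riemannUp_eq hU,
    h₂.riemannUp_eq hU, pd_christoffelUp_combination h₁ h₂ hU hlin,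
    pd_christoffelUp_combination h₁ h₂ hU hlin,
    ConnectionLinearAt.christoffelMatrix_mul_mul h₁ h₂ hU hdet hlin.self_of_nhds]
  simp only [Matrix.add_apply, Matrix.sub_apply, Matrix.smul_apply, smul_eq_mul,
    (hsymm i j).apply k l]
  ring

theorem Compatible.almostCompatible (h : Compatible U g₁ g₂) : AlmostCompatible U g₁ g₂ :=
  fun c₁ c₂ u hu hdet => (h c₁ c₂ u hu hdet).1

theorem AlmostCompatible.compatible (hU : IsOpen U) (h₁ : IsMetricOn U g₁)
    (h₂ : IsMetricOn U g₂) (hcomm : ∀ u ∈ U, HasCommCentralizer (affinor g₁ g₂ u))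
    (h : AlmostCompatible U g₁ g₂) : Compatible U g₁ g₂ := by
  intro c₁ c₂ u hu hdet
  have hu_nhds := hU.mem_nhds hu
  have hlin : ∀ᶠ w in 𝓝 u, ConnectionLinearAt c₁ c₂ g₁ g₂ w :=
    Filter.mem_of_superset (setOf_combination_det_ne_zero_mem_nhds h₁ h₂ hu_nhds hdet)
      fun w hw => h c₁ c₂ w hw.1 hw.2
  have hS (j : Fin N) : g₁ u * connectionDifference g₁ g₂ j u * g₂ u =
      g₂ u * connectionDifference g₁ g₂ j u * g₁ u :=
    sub_eq_zero.1 ((almostCompatible_iff_pencilDefect hU h₁ h₂).1 h u hu j)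
  refine ⟨h c₁ c₂ u hu hdet,
    curvatureLinearAt_of_isSymm h₁ h₂ hu_nhds hdet hlin fun i j => ?_⟩
  exact (hcomm u hu).isSymm_mul rfl hdet.isUnit (h₂.isUnit_det hu) (h₁.symm u hu) (h₂.symm u hu)
    (isSymm_connectionDifference h₁ h₂ hu_nhds i) (isSymm_connectionDifference h₁ h₂ hu_nhds j)
    (hS i) (hS j)

end Curvature

theorem NonsingularPair.hasCommCentralizer {U : Set (Fin N → ℝ)} {g₁ g₂ : MatrixField N}
    (h : NonsingularPair U g₁ g₂) (h₂ : IsMetricOn U g₂) (hu : u ∈ U) :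
    HasCommCentralizer (affinor g₁ g₂ u) := by
  let φ : Matrix (Fin N) (Fin N) ℝ →+* Matrix (Fin N) (Fin N) ℂ := Complex.ofRealHom.mapMatrix
  have hφ : Function.Injective φ := map_injective Complex.ofReal_injective
  have hdet : (φ (g₂ u)).det ≠ 0 := by
    rw [← RingHom.map_det]
    exact Complex.ofReal_ne_zero.2 (h₂.nondegenerate u hu)
  have hspectrum : spectrum ℂ (φ (affinor g₁ g₂ u)) =
      {z : ℂ | ((g₁ u).map Complex.ofReal - z • (g₂ u).map Complex.ofReal).det = 0} := by
    ext z
    have hfactor : (g₁ u).map Complex.ofReal - z • (g₂ u).map Complex.ofReal =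
        -(algebraMap ℂ _ z - φ (affinor g₁ g₂ u)) * φ (g₂ u) := by
      rw [neg_sub, sub_mul, ← map_mul, affinor_mul h₂ hu, Algebra.algebraMap_eq_smul_one,
        smul_mul_assoc, one_mul]
      rfl
    rw [spectrum.mem_iff, isUnit_iff_isUnit_det, isUnit_iff_ne_zero, not_not, Set.mem_ofPred_eq,
      hfactor, det_mul, mul_eq_zero_iff_right hdet, det_neg]
    simp
  refine .of_map hφ (hasCommCentralizer_of_ncard_spectrum ?_)
  rw [hspectrum, h u hu, Fintype.card_fin]

end MetricPencil

open MetricPencil in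
theorem theorem4_general {N : ℕ} (U : Set (Fin N → ℝ)) (hU : IsOpen U) (g₁ g₂ : MatrixField N)
    (h₁ : IsMetricOn U g₁) (h₂ : IsMetricOn U g₂) :
    (AlmostCompatible U g₁ g₂ ↔ NijenhuisVanishes U (affinor g₁ g₂)) ∧
    ((∀ u ∈ U, HasCommCentralizer (affinor g₁ g₂ u)) →
      (Compatible U g₁ g₂ ↔ AlmostCompatible U g₁ g₂)) :=
  ⟨(almostCompatible_iff_pencilDefect hU h₁ h₂).trans (forall₂_congr fun _ hu =>
      (nijenhuis_affinor_eq_zero_iff h₁ h₂ (hU.mem_nhds hu)).symm),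
    fun hcomm => ⟨Compatible.almostCompatible, AlmostCompatible.compatible hU h₁ h₂ hcomm⟩⟩

theorem theorem4 {N : ℕ} (U : Set (Fin N → ℝ)) (hU : IsOpen U)
    (g₁ g₂ : MetricPencil.MatrixField N)
    (h₁ : MetricPencil.IsMetricOn U g₁) (h₂ : MetricPencil.IsMetricOn U g₂) :
    ((MetricPencil.AlmostCompatible U g₁ g₂ →
        MetricPencil.NijenhuisVanishes U (MetricPencil.affinor g₁ g₂)) ∧
      (MetricPencil.Compatible U g₁ g₂ →
        MetricPencil.NijenhuisVanishes U (MetricPencil.affinor g₁ g₂))) ∧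
    (MetricPencil.NonsingularPair U g₁ g₂ →
      (MetricPencil.NijenhuisVanishes U (MetricPencil.affinor g₁ g₂) →
        MetricPencil.Compatible U g₁ g₂) ∧
      (MetricPencil.Compatible U g₁ g₂ ↔ MetricPencil.AlmostCompatible U g₁ g₂)) := by
  obtain ⟨hac, hc⟩ := theorem4_general U hU g₁ g₂ h₁ h₂
  exact ⟨⟨hac.1, hac.1 ∘ MetricPencil.Compatible.almostCompatible⟩, fun hns =>
    have hiff := hc fun u hu => hns.hasCommCentralizer h₂ hu
    ⟨hiff.2 ∘ hac.2, hiff⟩⟩
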